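/- Let $K$ be a field of characteristic $p$ ($p=0$ or $p$ prime), let $r,d\ge 0$ be integers, let $R=K[x_1,\dots,x_r]$ with the standard grading, and let $$I'=(x_1^2,\dots,x_r^2)+(\text{all squarefree monomials of degree } d)\subseteq R,\qquad A=R/I'=\bigoplus_{i\ge 0}A_i .$$ Say that $A$ has the weak Lefschetz property (WLP) if there is a linear form $\ell\in R_1$ such that for every $i\ge 0$ the multiplication map $\times\ell:A_i\to A_{i+1}$ is injective or surjective. Then: 1. $A$ has the WLP whenever $p$ is not a prime number that is less than $i+2$ for some integer $i$ with $1\le i\le\lceil r/2\rceil$. 2. The characteristics in which the WLP fails are exactly the following: $A$ does not have the WLP if and only if $p$ is a prime number with $p<d$ and $p\le\lceil r/2\rceil$. 3. For every field $F$ of characteristic $p$ (for instance the prime field $\mathbb{Z}/p\mathbb{Z}$ if $p$ is prime), $A$ has the WLP if and only if for every $i\ge 0$ with $i+1<d$ the $\binom ri\times\binom r{i+1}$ matrix over $F$ whose rows are indexed by the $i$-subsets $S$ and whose columns are indexed by the $(i+1)$-subsets $T$ of $\{1,\dots,r\}$, with entry $1$ if $S\subseteq T$ and $0$ otherwise, has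 rank $\min\left\{\binom ri,\binom r{i+1}\right\}$. -/

import Mathlib

namespace Lefschetz

open MvPolynomial

variable {K : Type*} [Field K] {r : ℕ}

/-- The degree `i` component `A_i` of `A = K[x_1, …, x_r] / I`, for the standard grading:
the image in `A` of the homogeneous polynomials of degree `i`. -/
noncomputable def gradedPiece (I : Ideal (MvPolynomial (Fin r) K)) (i : ℕ) :
    Submodule K (MvPolynomial (Fin r) K ⧸ I) :=
  (homogeneousSubmodule (Fin r) K i).map (Ideal.Quotient.mkₐ K I).toLinearMap

/-- Multiplication by a linear form sends `A_i` into `A_{i+1}`. -/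
theorem mul_mem_gradedPiece (I : Ideal (MvPolynomial (Fin r) K))
    {l : MvPolynomial (Fin r) K} (hl : l.IsHomogeneous 1) (i : ℕ) :
    ∀ a ∈ gradedPiece I i,
      LinearMap.mulLeft K (Ideal.Quotient.mk I l) a ∈ gradedPiece I (i + 1) := by
  rintro a ⟨f, hf, rfl⟩
  refine ⟨l * f, ?_, by simp⟩
  have hf' : f.IsHomogeneous i := hf
  have h := hl.mul hf'
  rw [add_comm] at h
  exact h

/-- The `K`-linear map `×ℓ : A_i → A_{i+1}` induced by a linear form `ℓ`. -/
noncomputable def mulForm (I : Ideal (MvPolynomial (Fin r) K))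
    {l : MvPolynomial (Fin r) K} (hl : l.IsHomogeneous 1) (i : ℕ) :
    gradedPiece I i →ₗ[K] gradedPiece I (i + 1) :=
  (LinearMap.mulLeft K (Ideal.Quotient.mk I l)).restrict (mul_mem_gradedPiece I hl i)

/-- The weak Lefschetz property of `A = K[x_1, …, x_r] / I` (for `I` homogeneous and `A`
Artinian): there is a linear form `ℓ` such that every map `×ℓ : A_i → A_{i+1}` has maximal rank,
i.e. is injective or surjective. If `A_e` is the last nonzero component, the maps with `i ≥ e`
have target `0`, hence are surjective, so the condition is the one for `0 ≤ i ≤ e - 1`. -/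
def HasWLP (I : Ideal (MvPolynomial (Fin r) K)) : Prop :=
  ∃ (l : MvPolynomial (Fin r) K) (hl : l.IsHomogeneous 1), ∀ i : ℕ,
    Function.Injective (mulForm I hl i) ∨ Function.Surjective (mulForm I hl i)

variable (K r) in
/-- The ideal `(x_1 ^ 2, …, x_r ^ 2) + (all squarefree monomials of degree d)`
of `K[x_1, …, x_r]`. -/
noncomputable def squarefreeIdeal (d : ℕ) : Ideal (MvPolynomial (Fin r) K) :=
  Ideal.span (Set.range fun j : Fin r => (X j : MvPolynomial (Fin r) K) ^ 2) ⊔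
    Ideal.span {m | ∃ S : Finset (Fin r), S.card = d ∧ m = ∏ j ∈ S, X j}

/-- The inclusion matrix over `F` of the `i`-subsets versus the `(i+1)`-subsets of an `r`-set:
the entry at `(S, T)` is `1` if `S ⊆ T` and `0` otherwise. -/
def inclusionMatrix (F : Type*) [Field F] (r i : ℕ) :
    Matrix {S : Finset (Fin r) // S.card = i} {T : Finset (Fin r) // T.card = i + 1} F :=
  Matrix.of fun S T => if S.1 ⊆ T.1 then 1 else 0

end Lefschetz

/-!
The classes of the squarefree monomials of degree less than `d` form a basis of `A`, so `A_i` is the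
space of functions on the `i`-subsets of `{1, …, r}` for `i < d`, and zero for `i ≥ d`
(`mem_squarefreeIdeal_iff`, `toGradedPiece_bijective`). In these bases, multiplication by
`∑ j, a j • x_j` is the map `raise a i`, and for `a = 1` its matrix is the transposed inclusion
matrix. Only the degrees `i` with `i + 1 < d` matter, since the later maps have target zero
(`hasWLP_squarefreeIdeal_iff_exists_raise`).

* If no prime `p ≤ min (i + 1) (r - i)` is the characteristic, the sum of the variables has maximal
  rank in degree `i` (`raise_one_injective_or_surjective`). When `2 i + 1 ≤ r`, an element `f` of the
  kernel is killed by choosing, for an `i`-set `A`, an `(i + 1)`-set `B` disjoint from it, and adding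
  up the relations indexed by the `(i + 1)`-subsets `T` of `A ∪ B`, weighted by
  `(-1) ^ k * k! * (i - k)!` where `k = |T ∩ A|`: every value of `f` cancels except `f A`, which gets
  the coefficient `± (i + 1)!` (`factorial_mul_eq_zero`). The remaining degrees follow by taking
  complements of subsets.
* If `p` is the characteristic, `p < d` and `2 p ≤ r + 1`, every linear form `ℓ` fails in degree
  `p - 1`: there `dim A_{p-1} ≤ dim A_p`, while `ℓ ^ p = 0` provides a kernel element
  (`not_raise_injective_or_surjective`).

Hence both the WLP over `K` and the full rank of all the inclusion matrices over `F` are equivalent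
to the same arithmetic condition `¬ (p.Prime ∧ p < d ∧ 2 * p ≤ r + 1)`.
-/

namespace Lefschetz

open MvPolynomial

/-! ### Sums over subsets of a finite set -/

section Combinatorics

variable {α F : Type*} [DecidableEq α] [Field F]

/-- Double counting of the pairs `S ⊂ T` with `|T| = |S| + 1` inside `U`. -/
theorem sum_powersetCard_sum_erase (U : Finset α) (t : ℕ) (G : Finset α → Finset α → F) :
    ∑ T ∈ U.powersetCard (t + 1), ∑ j ∈ T, G T (T.erase j) =
      ∑ S ∈ U.powersetCard t, ∑ j ∈ U \ S, G (insert j S) S := by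
  rw [Finset.sum_sigma', Finset.sum_sigma']
  refine Finset.sum_bij' (fun x _ => ⟨x.1.erase x.2, x.2⟩) (fun x _ => ⟨insert x.2 x.1, x.2⟩)
    ?_ ?_ ?_ ?_ ?_
  · rintro ⟨T, j⟩ h
    simp only [Finset.mem_sigma, Finset.mem_powersetCard, Finset.mem_sdiff] at h ⊢
    obtain ⟨⟨hTU, hT⟩, hj⟩ := h
    refine ⟨⟨(Finset.erase_subset _ _).trans hTU, ?_⟩, hTU hj, Finset.notMem_erase _ _⟩
    rw [Finset.card_erase_of_mem hj, hT, Nat.add_sub_cancel]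
  · rintro ⟨S, j⟩ h
    simp only [Finset.mem_sigma, Finset.mem_powersetCard, Finset.mem_sdiff] at h ⊢
    obtain ⟨⟨hSU, hS⟩, hjU, hj⟩ := h
    refine ⟨⟨Finset.insert_subset hjU hSU, ?_⟩, Finset.mem_insert_self _ _⟩
    rw [Finset.card_insert_of_notMem hj, hS]
  · rintro ⟨T, j⟩ h
    simp only [Finset.mem_sigma] at h
    simp [Finset.insert_erase h.2]
  · rintro ⟨S, j⟩ h
    simp only [Finset.mem_sigma, Finset.mem_sdiff] at h
    simp [Finset.erase_insert h.2.2]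
  · rintro ⟨T, j⟩ h
    simp only [Finset.mem_sigma] at h
    simp [Finset.insert_erase h.2]

/-- If every `(t + 1)`-set `T` has `∑ j ∈ T, f (T \ {j}) = 0`, then `(t + 1)! * f A = 0` for each
`t`-set `A` having `t + 1` points outside it: weight the relation at `T ⊆ A ∪ B` by
`(-1) ^ k * k! * (t - k)!` with `k = |T ∩ A|`; after summation only `f A` survives. -/
theorem factorial_mul_eq_zero (f : Finset α → F) (t : ℕ)
    (hf : ∀ T : Finset α, T.card = t + 1 → ∑ j ∈ T, f (T.erase j) = 0)
    {A B : Finset α} (hA : A.card = t) (hB : B.card = t + 1) (hAB : Disjoint A B) :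
    ((t + 1).factorial : F) * f A = 0 := by
  let c : ℕ → F := fun k =>
    if k ≤ t then (-1) ^ k * k.factorial * (t - k).factorial else 0
  have key := sum_powersetCard_sum_erase (A ∪ B) t fun T S => c (T ∩ A).card * f S
  have h0 : ∑ T ∈ (A ∪ B).powersetCard (t + 1), ∑ j ∈ T, c (T ∩ A).card * f (T.erase j) = 0 := by
    refine Finset.sum_eq_zero fun T hT => ?_
    rw [← Finset.mul_sum, hf T (Finset.mem_powersetCard.1 hT).2, mul_zero]
  -- The total weight received by `f S` depends only on `|S ∩ A|`.
  have hw : ∀ S ∈ (A ∪ B).powersetCard t,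
      ∑ j ∈ (A ∪ B) \ S, c (insert j S ∩ A).card * f S =
        ((t - (S ∩ A).card : ℕ) * c ((S ∩ A).card + 1) + ((S ∩ A).card + 1) * c (S ∩ A).card)
          * f S := by
    intro S hS
    obtain ⟨hSU, hS⟩ := Finset.mem_powersetCard.1 hS
    have hdis : Disjoint (A \ S) (B \ S) :=
      hAB.mono Finset.sdiff_subset Finset.sdiff_subset
    have hAS : (A \ S).card = t - (S ∩ A).card := by
      rw [Finset.card_sdiff, hA]
    have hSB : (S ∩ A).card + (S ∩ B).card = t := by
      rw [← Finset.card_union_of_disjoint (hAB.mono Finset.inter_subset_right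
        Finset.inter_subset_right), ← Finset.inter_union_distrib_left,
        Finset.inter_eq_left.2 hSU, hS]
    have hBS : (B \ S).card = (S ∩ A).card + 1 := by
      rw [Finset.card_sdiff, hB]; omega
    rw [← Finset.sum_mul, Finset.union_sdiff_distrib, Finset.sum_union hdis]
    congr 1
    have h1 : ∀ j ∈ A \ S, c (insert j S ∩ A).card = c ((S ∩ A).card + 1) := by
      intro j hj
      rw [Finset.mem_sdiff] at hj
      rw [Finset.insert_inter_of_mem hj.1, Finset.card_insert_of_notMem
        fun h => hj.2 (Finset.mem_inter.1 h).1]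
    have h2 : ∀ j ∈ B \ S, c (insert j S ∩ A).card = c (S ∩ A).card := by
      intro j hj
      rw [Finset.mem_sdiff] at hj
      rw [Finset.insert_inter_of_notMem (Finset.disjoint_right.1 hAB hj.1)]
    rw [Finset.sum_congr rfl h1, Finset.sum_congr rfl h2, Finset.sum_const, Finset.sum_const,
      hAS, hBS]
    simp
  have hcancel : ∀ k, k < t → ((t - k : ℕ) : F) * c (k + 1) + (k + 1) * c k = 0 := by
    intro k hk
    obtain ⟨m, rfl⟩ : ∃ m, t = k + 1 + m := ⟨t - (k + 1), by omega⟩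
    have e1 : k + 1 + m - k = m + 1 := by omega
    have e2 : k + 1 + m - (k + 1) = m := by omega
    simp only [c, if_pos (show k + 1 ≤ k + 1 + m by omega), if_pos (show k ≤ k + 1 + m by omega),
      e1, e2, Nat.factorial_succ, pow_succ]
    push_cast
    ring
  rw [h0, Finset.sum_congr rfl hw, Finset.sum_eq_single A] at key
  · have e : (A ∩ A).card = t := by rw [Finset.inter_self, hA]
    rw [e] at key
    simp only [c, Nat.sub_self, le_refl, if_true, if_neg (show ¬ t + 1 ≤ t by omega),
      Nat.factorial_zero] at key
    have h3 : (-1 : F) ^ t * (((t + 1).factorial : F) * f A) = 0 := by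
      rw [Nat.factorial_succ]; push_cast; rw [key]; push_cast; ring
    exact (mul_eq_zero.1 h3).resolve_left (pow_ne_zero _ (neg_ne_zero.2 one_ne_zero))
  · intro S hS hSA
    obtain ⟨-, hS⟩ := Finset.mem_powersetCard.1 hS
    have hlt : (S ∩ A).card < t := by
      refine lt_of_le_of_ne (hS ▸ Finset.card_le_card Finset.inter_subset_left) fun h => hSA ?_
      have h1 : S ∩ A = S := Finset.eq_of_subset_of_card_le Finset.inter_subset_left (by omega)
      have h2 : S ∩ A = A := Finset.eq_of_subset_of_card_le Finset.inter_subset_right (by omega)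
      rw [← h1, h2]
    rw [hcancel _ hlt, zero_mul]
  · intro h
    exact absurd (Finset.mem_powersetCard.2 ⟨Finset.subset_union_left, hA⟩) h

/-- For `2 t + 1 ≤ |α|` and `(t + 1)!` invertible, a function on `t`-sets is determined by its
sums over the facets of the `(t + 1)`-sets. -/
theorem eq_zero_of_sum_erase_eq_zero [Fintype α] (f : Finset α → F) {t : ℕ}
    (ht : 2 * t + 1 ≤ Fintype.card α) (hF : ((t + 1).factorial : F) ≠ 0)
    (hf : ∀ T : Finset α, T.card = t + 1 → ∑ j ∈ T, f (T.erase j) = 0)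
    {A : Finset α} (hA : A.card = t) : f A = 0 := by
  obtain ⟨B, hBA, hB⟩ := Finset.exists_subset_card_eq
    (show t + 1 ≤ Aᶜ.card by rw [Finset.card_compl]; omega)
  exact (mul_eq_zero.1 (factorial_mul_eq_zero f t hf hA hB
    ((Finset.disjoint_of_subset_left hBA disjoint_compl_left).symm))).resolve_left hF

/-- The dual of `eq_zero_of_sum_erase_eq_zero`, by passing to complements. -/
theorem eq_zero_of_sum_insert_eq_zero [Fintype α] (g : Finset α → F) {t u : ℕ}
    (htu : t + u + 1 = Fintype.card α) (hut : u ≤ t) (hF : ((u + 1).factorial : F) ≠ 0)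
    (hg : ∀ S : Finset α, S.card = t → ∑ j ∈ Sᶜ, g (insert j S) = 0)
    {T : Finset α} (hT : T.card = t + 1) : g T = 0 := by
  have := eq_zero_of_sum_erase_eq_zero (fun X => g Xᶜ) (t := u) (by omega) hF ?_
    (A := Tᶜ) (by rw [Finset.card_compl]; omega)
  · simpa using this
  · intro X hX
    rw [← hg Xᶜ (by rw [Finset.card_compl]; omega), compl_compl]
    refine Finset.sum_congr rfl fun j _ => ?_
    rw [Finset.compl_erase]

theorem sum_powersetCard_eq_sum_erase (f : Finset α → F) {i : ℕ} {T : Finset α}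
    (hT : T.card = i + 1) : ∑ S ∈ T.powersetCard i, f S = ∑ j ∈ T, f (T.erase j) := by
  have h := sum_powersetCard_sum_erase T i fun _ S => f S
  rw [← hT, Finset.powersetCard_self, Finset.sum_singleton] at h
  rw [h]
  refine Finset.sum_congr rfl fun S hS => ?_
  obtain ⟨hST, hS⟩ := Finset.mem_powersetCard.1 hS
  rw [Finset.sum_const, Finset.card_sdiff_of_subset hST, hS, hT, Nat.add_sub_cancel_left, one_smul]

end Combinatorics

/-! ### Raising maps and inclusion matrices -/

section Raising

variable {F : Type*} [Field F] {r : ℕ}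

/-- Extension by zero of a function on the `i`-subsets to all subsets. -/
def extendZero {i : ℕ} (v : {S : Finset (Fin r) // S.card = i} → F) (S : Finset (Fin r)) : F :=
  if h : S.card = i then v ⟨S, h⟩ else 0

theorem extendZero_of_card {i : ℕ} (v : {S : Finset (Fin r) // S.card = i} → F)
    {S : Finset (Fin r)} (h : S.card = i) : extendZero v S = v ⟨S, h⟩ := dif_pos h

theorem extendZero_coe {i : ℕ} (v : {S : Finset (Fin r) // S.card = i} → F)
    (S : {S : Finset (Fin r) // S.card = i}) : extendZero v S.1 = v S := dif_pos S.2

/-- Multiplication by `∑ j, a j • x_j` in degree `i` of the squarefree algebra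
`F[x_1, …, x_r] / (x_1 ^ 2, …, x_r ^ 2)`, in the bases of squarefree monomials. -/
def raise (a : Fin r → F) (i : ℕ) : ({S : Finset (Fin r) // S.card = i} → F) →ₗ[F]
    ({T : Finset (Fin r) // T.card = i + 1} → F) where
  toFun v T := ∑ j ∈ T.1, a j * extendZero v (T.1.erase j)
  map_add' v w := by
    ext T
    rw [Pi.add_apply, ← Finset.sum_add_distrib]
    refine Finset.sum_congr rfl fun j _ => ?_
    by_cases h : (T.1.erase j).card = i <;> simp [extendZero, h, mul_add]
  map_smul' c v := by
    ext T
    simp only [RingHom.id_apply, Pi.smul_apply, smul_eq_mul]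
    rw [Finset.mul_sum]
    refine Finset.sum_congr rfl fun j _ => ?_
    by_cases h : (T.1.erase j).card = i <;> simp [extendZero, h, mul_left_comm]

theorem raise_apply (a : Fin r → F) (i : ℕ) (v : {S : Finset (Fin r) // S.card = i} → F)
    (T : {T : Finset (Fin r) // T.card = i + 1}) :
    raise a i v T = ∑ j ∈ T.1, a j * extendZero v (T.1.erase j) := rfl

theorem card_subtype_card_eq (r i : ℕ) :
    Fintype.card {S : Finset (Fin r) // S.card = i} = r.choose i := by
  rw [Fintype.card_finset_len, Fintype.card_fin]

theorem sum_subtype_card_eq (i : ℕ) (f : Finset (Fin r) → F) :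
    ∑ S : {S : Finset (Fin r) // S.card = i}, f S.1 =
      ∑ S ∈ Finset.univ.powersetCard i, f S := by
  rw [← Finset.sum_subtype (Finset.univ.powersetCard i) (by simp) f]

theorem inclusionMatrix_transpose_mulVec (i : ℕ)
    (v : {S : Finset (Fin r) // S.card = i} → F) :
    (inclusionMatrix F r i).transpose.mulVec v = raise 1 i v := by
  ext T
  have h1 : ∀ S : {S : Finset (Fin r) // S.card = i},
      (inclusionMatrix F r i).transpose T S * v S =
        if S.1 ⊆ T.1 then extendZero v S.1 else 0 := by
    intro S
    simp [inclusionMatrix, extendZero_coe]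
  have h2 : (Finset.univ.powersetCard i).filter (fun S => S ⊆ T.1) = T.1.powersetCard i := by
    ext S; simp [Finset.mem_powersetCard, and_comm]
  rw [raise_apply, Matrix.mulVec, dotProduct, Finset.sum_congr rfl fun S _ => h1 S,
    sum_subtype_card_eq i fun S => if S ⊆ T.1 then extendZero v S else 0, ← Finset.sum_filter, h2,
    sum_powersetCard_eq_sum_erase _ T.2]
  simp

theorem inclusionMatrix_mulVec (i : ℕ) (w : {T : Finset (Fin r) // T.card = i + 1} → F)
    (S : {S : Finset (Fin r) // S.card = i}) :
    (inclusionMatrix F r i).mulVec w S = ∑ j ∈ S.1ᶜ, extendZero w (insert j S.1) := by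
  have h1 : ∀ T : {T : Finset (Fin r) // T.card = i + 1},
      inclusionMatrix F r i S T * w T = if S.1 ⊆ T.1 then extendZero w T.1 else 0 := by
    intro T
    simp [inclusionMatrix, extendZero_coe]
  have h2 : (Finset.univ.powersetCard (i + 1)).filter (fun T => S.1 ⊆ T) =
      S.1ᶜ.image fun j => insert j S.1 := by
    ext T
    simp only [Finset.mem_filter, Finset.mem_powersetCard, Finset.subset_univ, true_and,
      Finset.mem_image, Finset.mem_compl]
    constructor
    · rintro ⟨hT, hST⟩
      obtain ⟨j, hj⟩ := Finset.card_eq_one.1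
        (show (T \ S.1).card = 1 by rw [Finset.card_sdiff_of_subset hST, hT, S.2]; omega)
      refine ⟨j, (Finset.mem_sdiff.1 (hj ▸ Finset.mem_singleton_self j)).2, ?_⟩
      rw [← Finset.sdiff_union_of_subset hST, hj, Finset.insert_eq]
    · rintro ⟨j, hj, rfl⟩
      exact ⟨by rw [Finset.card_insert_of_notMem hj, S.2], Finset.subset_insert _ _⟩
  rw [Matrix.mulVec, dotProduct, Finset.sum_congr rfl fun T _ => h1 T,
    sum_subtype_card_eq (i + 1) fun T => if S.1 ⊆ T then extendZero w T else 0,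
    ← Finset.sum_filter, h2, Finset.sum_image]
  intro j hj k _ hjk
  have hjk : insert j S.1 = insert k S.1 := hjk
  have : j ∈ insert k S.1 := hjk ▸ Finset.mem_insert_self j S.1
  exact (Finset.mem_insert.1 this).resolve_right (Finset.mem_compl.1 hj)

theorem injective_iff_finrank_range {V W : Type*} [AddCommGroup V] [Module F V] [AddCommGroup W]
    [Module F W] [FiniteDimensional F V] (L : V →ₗ[F] W) :
    Function.Injective L ↔ Module.finrank F (LinearMap.range L) = Module.finrank F V := by
  have h := L.finrank_range_add_finrank_ker
  rw [← LinearMap.ker_eq_bot, ← Submodule.finrank_eq_zero (R := F)]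
  omega

theorem surjective_iff_finrank_range {V W : Type*} [AddCommGroup V] [Module F V] [AddCommGroup W]
    [Module F W] [FiniteDimensional F W] (L : V →ₗ[F] W) :
    Function.Surjective L ↔ Module.finrank F (LinearMap.range L) = Module.finrank F W := by
  rw [← LinearMap.range_eq_top]
  exact ⟨fun h => by rw [h, finrank_top], Submodule.eq_top_of_finrank_eq⟩

theorem rank_inclusionMatrix (F : Type*) [Field F] (r i : ℕ) :
    (inclusionMatrix F r i).rank =
      Module.finrank F (LinearMap.range (raise (F := F) (r := r) 1 i)) := by
  rw [← Matrix.rank_transpose, Matrix.rank]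
  have h : (inclusionMatrix F r i).transpose.mulVecLin = raise 1 i :=
    LinearMap.ext fun v => inclusionMatrix_transpose_mulVec i v
  rw [h]

theorem finrank_subsets (F : Type*) [Field F] (r i : ℕ) :
    Module.finrank F ({S : Finset (Fin r) // S.card = i} → F) = r.choose i := by
  rw [Module.finrank_fintype_fun_eq_card, card_subtype_card_eq]

theorem raise_one_injective_iff (i : ℕ) : Function.Injective (raise (F := F) (r := r) 1 i) ↔
    (inclusionMatrix F r i).rank = r.choose i := by
  rw [injective_iff_finrank_range, rank_inclusionMatrix, finrank_subsets]

theorem raise_one_surjective_iff (i : ℕ) : Function.Surjective (raise (F := F) (r := r) 1 i) ↔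
    (inclusionMatrix F r i).rank = r.choose (i + 1) := by
  rw [surjective_iff_finrank_range, rank_inclusionMatrix, finrank_subsets]

theorem rank_inclusionMatrix_eq_min_iff (i : ℕ) :
    (inclusionMatrix F r i).rank = min (r.choose i) (r.choose (i + 1)) ↔
      Function.Injective (raise (F := F) (r := r) 1 i) ∨
        Function.Surjective (raise (F := F) (r := r) 1 i) := by
  have h1 : (inclusionMatrix F r i).rank ≤ r.choose i :=
    (Matrix.rank_le_card_height _).trans_eq (card_subtype_card_eq r i)
  have h2 : (inclusionMatrix F r i).rank ≤ r.choose (i + 1) :=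
    (Matrix.rank_le_card_width _).trans_eq (card_subtype_card_eq r (i + 1))
  rw [raise_one_injective_iff, raise_one_surjective_iff]
  omega

theorem factorial_cast_ne_zero (p : ℕ) [CharP F p] {n : ℕ} (h : p.Prime → n < p) :
    (n.factorial : F) ≠ 0 := by
  rw [Ne, CharP.cast_eq_zero_iff F p]
  rcases CharP.char_is_prime_or_zero F p with hp | rfl
  · rw [hp.dvd_factorial]
    exact not_le.2 (h hp)
  · rw [zero_dvd_iff]
    exact Nat.factorial_ne_zero n

/-- Outside the characteristics `p ≤ min (i + 1) (r - i)`, the `i`-th inclusion map has maximal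
rank: it is injective in the lower half of the Boolean lattice and surjective in the upper half. -/
theorem raise_one_injective_or_surjective (p : ℕ) [CharP F p] {i : ℕ}
    (hp : ¬ (p.Prime ∧ p ≤ i + 1 ∧ p + i ≤ r)) :
    Function.Injective (raise (F := F) (r := r) 1 i) ∨
      Function.Surjective (raise (F := F) (r := r) 1 i) := by
  rcases le_or_gt (2 * i + 1) r with h | h
  · left
    have hF : ((i + 1).factorial : F) ≠ 0 :=
      factorial_cast_ne_zero p fun hpp => by by_contra; exact hp ⟨hpp, by omega, by omega⟩
    rw [injective_iff_map_eq_zero]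
    intro v hv
    ext S
    rw [← extendZero_coe v S]
    refine eq_zero_of_sum_erase_eq_zero (extendZero v) (by simpa using h) hF ?_ S.2
    intro T hT
    simpa [raise_apply] using congrFun hv ⟨T, hT⟩
  · right
    rcases le_or_gt r i with hri | hri
    · intro w
      refine ⟨0, funext fun T => ?_⟩
      have := Finset.card_le_univ T.1
      rw [T.2, Fintype.card_fin] at this
      omega
    -- Full column rank of the inclusion matrix, by the injectivity of the transposed map.
    obtain ⟨u, hu⟩ : ∃ u, i + u + 1 = r := ⟨r - i - 1, by omega⟩
    have hF : ((u + 1).factorial : F) ≠ 0 :=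
      factorial_cast_ne_zero p fun hpp => by by_contra; exact hp ⟨hpp, by omega, by omega⟩
    have hinj : Function.Injective (inclusionMatrix F r i).mulVecLin := by
      rw [injective_iff_map_eq_zero]
      intro w hw
      ext T
      rw [← extendZero_coe w T]
      refine eq_zero_of_sum_insert_eq_zero (extendZero w) (by simpa using hu) (by omega) hF ?_ T.2
      intro S hS
      rw [← inclusionMatrix_mulVec i w ⟨S, hS⟩]
      exact congrFun hw ⟨S, hS⟩
    rw [raise_one_surjective_iff, Matrix.rank, (injective_iff_finrank_range _).1 hinj,
      finrank_subsets]

/-- In characteristic `p` with `2 p ≤ r + 1`, no linear form `ℓ = ∑ j, a j • x_j` has maximal rank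
from degree `p - 1` to degree `p`. A kernel element is, up to the factor `(p - 1)!`, the power
`ℓ ^ (p - 1)`, as `ℓ ^ p = 0`; when that power vanishes, some squarefree monomial of degree `p - 1`
is divisible by all variables occurring in `ℓ`. -/
theorem not_raise_injective_or_surjective {p q : ℕ} [CharP F p] (hq : q + 1 = p)
    (hr : 2 * p ≤ r + 1) (a : Fin r → F) :
    ¬ (Function.Injective (raise a q) ∨ Function.Surjective (raise a q)) := by
  classical
  subst hq
  have hle : r.choose q ≤ r.choose (q + 1) := by
    have h := Nat.choose_succ_right_eq r q
    refine Nat.le_of_mul_le_mul_right ?_ (Nat.succ_pos q)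
    rw [Nat.succ_eq_add_one, h]
    exact Nat.mul_le_mul_left _ (by omega)
  have hinj : ¬ Function.Injective (raise a q) := by
    rw [injective_iff_map_eq_zero]
    intro h
    let supp : Finset (Fin r) := Finset.univ.filter fun j => a j ≠ 0
    rcases le_total q supp.card with hs | hs
    · obtain ⟨S, hSs, hS⟩ := Finset.exists_subset_card_eq hs
      have h0 := h (fun S => ∏ j ∈ S.1, a j) (by
        ext T
        have hT : ∀ j ∈ T.1, a j * extendZero
            (fun S : {S : Finset (Fin r) // S.card = q} => ∏ j ∈ S.1, a j) (T.1.erase j) =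
              ∏ j ∈ T.1, a j := by
          intro j hj
          rw [extendZero_of_card _ (by rw [Finset.card_erase_of_mem hj, T.2]; omega),
            Finset.mul_prod_erase _ _ hj]
        rw [raise_apply, Finset.sum_congr rfl hT, Finset.sum_const, T.2, nsmul_eq_mul,
          CharP.cast_eq_zero, zero_mul, Pi.zero_apply])
      exact Finset.prod_ne_zero_iff.2 (fun j hj => (Finset.mem_filter.1 (hSs hj)).2)
        (congrFun h0 ⟨S, hS⟩)
    · obtain ⟨S, hsS, -, hS⟩ := Finset.exists_subsuperset_card_eq
        (Finset.subset_univ supp) hs (by rw [Finset.card_univ, Fintype.card_fin]; omega)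
      have h0 := h (Pi.single ⟨S, hS⟩ 1) (by
        ext T
        rw [raise_apply]
        refine Finset.sum_eq_zero fun j hj => ?_
        by_cases hTS : T.1.erase j = S
        · have hjS : j ∉ supp := fun hj => Finset.notMem_erase j T.1 (hTS ▸ hsS hj)
          have : a j = 0 := by simpa [supp] using hjS
          rw [this, zero_mul]
        · rw [extendZero_of_card _ (by rw [Finset.card_erase_of_mem hj, T.2]; omega),
            Pi.single_eq_of_ne (fun h => hTS (congrArg Subtype.val h)), mul_zero])
      have := congrFun h0 ⟨S, hS⟩
      rw [Pi.single_eq_same] at this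
      exact one_ne_zero this
  rintro (h | h)
  · exact hinj h
  · -- A surjection onto a space of at least the same dimension is injective.
    refine hinj ((injective_iff_finrank_range _).2 (le_antisymm
      (LinearMap.finrank_range_le _) ?_))
    rw [(surjective_iff_finrank_range _).1 h, finrank_subsets, finrank_subsets]
    exact hle

end Raising

/-! ### The graded pieces of the squarefree algebra -/

section SquarefreeAlgebra

variable {K : Type*} [Field K] {r : ℕ}

/-- The exponent of the squarefree monomial `∏ j ∈ S, x_j`. -/
noncomputable def expo (S : Finset (Fin r)) : Fin r →₀ ℕ := ∑ j ∈ S, Finsupp.single j 1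

theorem expo_apply (S : Finset (Fin r)) (j : Fin r) : expo S j = if j ∈ S then 1 else 0 := by
  simp [expo, Finsupp.finsetSum_apply, Finsupp.single_apply]

theorem prod_X_eq_monomial (S : Finset (Fin r)) :
    ∏ j ∈ S, (X j : MvPolynomial (Fin r) K) = monomial (expo S) 1 := by
  rw [expo, monomial_sum_one]; rfl

theorem expo_injective : Function.Injective (expo (r := r)) := by
  intro S T h
  ext j
  have := DFunLike.congr_fun h j
  rw [expo_apply, expo_apply] at this
  by_cases hS : j ∈ S <;> by_cases hT : j ∈ T <;> simp_all

theorem expo_le_expo {S T : Finset (Fin r)} : expo S ≤ expo T ↔ S ⊆ T := by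
  constructor
  · intro h j hj
    have := h j
    rw [expo_apply, expo_apply, if_pos hj] at this
    by_contra hT
    simp [hT] at this
  · intro h j
    rw [expo_apply, expo_apply]
    by_cases hj : j ∈ S
    · simp [hj, h hj]
    · simp [hj]

theorem degree_expo (S : Finset (Fin r)) : (expo S).degree = S.card := by
  simp [expo, map_sum]

theorem expo_erase {T : Finset (Fin r)} {j : Fin r} (hj : j ∈ T) :
    expo T - Finsupp.single j 1 = expo (T.erase j) := by
  rw [expo, ← Finset.add_sum_erase _ _ hj, add_tsub_cancel_left, expo]

/-- Membership in the monomial ideal `squarefreeIdeal K r d`, read off from coefficients: the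
squarefree monomials of degree less than `d` form a basis of the quotient. -/
theorem mem_squarefreeIdeal_iff {d : ℕ} {f : MvPolynomial (Fin r) K} :
    f ∈ squarefreeIdeal K r d ↔ ∀ S : Finset (Fin r), S.card < d → coeff (expo S) f = 0 := by
  have hI : squarefreeIdeal K r d = Ideal.span ((fun s => monomial s (1 : K)) ''
      ((Set.range fun j : Fin r => Finsupp.single j 2) ∪ {s | ∃ S, S.card = d ∧ s = expo S})) := by
    rw [squarefreeIdeal, ← Ideal.span_union, Set.image_union, ← Set.range_comp]
    congr 2
    · congr 1
      funext j
      simp [X_pow_eq_monomial]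
    · ext m
      simp only [Set.mem_ofPred_eq, Set.mem_image, prod_X_eq_monomial]
      constructor
      · rintro ⟨S, hS, rfl⟩
        exact ⟨_, ⟨S, hS, rfl⟩, rfl⟩
      · rintro ⟨_, ⟨S, hS, rfl⟩, rfl⟩
        exact ⟨S, hS, rfl⟩
  rw [hI, mem_ideal_span_monomial_image]
  constructor
  · intro h S hS
    by_contra hc
    obtain ⟨s, hs, hle⟩ := h _ (mem_support_iff.2 hc)
    rcases hs with ⟨j, rfl⟩ | ⟨S', hS', rfl⟩
    · have := hle j
      simp only [Finsupp.single_eq_same, expo_apply] at this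
      split_ifs at this <;> omega
    · have := Finset.card_le_card (expo_le_expo.1 hle)
      omega
  · intro h s hs
    by_cases h2 : ∃ j, 2 ≤ s j
    · obtain ⟨j, hj⟩ := h2
      exact ⟨_, Or.inl ⟨j, rfl⟩, Finsupp.single_le_iff.2 hj⟩
    · push Not at h2
      have hse : s = expo s.support := by
        ext j
        rw [expo_apply]
        have := h2 j
        by_cases hj : s j = 0
        · simp [hj]
        · rw [if_pos (Finsupp.mem_support_iff.2 hj)]; omega
      have hd : d ≤ s.support.card := by
        by_contra hlt
        exact mem_support_iff.1 hs (hse ▸ h s.support (by omega))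
      obtain ⟨S, hSs, hS⟩ := Finset.exists_subset_card_eq hd
      refine ⟨_, Or.inr ⟨S, hS, rfl⟩, ?_⟩
      rw [hse]
      exact expo_le_expo.2 hSs

/-- The squarefree form of degree `i` with prescribed coefficients. -/
noncomputable def squarefreeForm (i : ℕ) : ({S : Finset (Fin r) // S.card = i} → K) →ₗ[K]
    MvPolynomial (Fin r) K :=
  ∑ S : {S : Finset (Fin r) // S.card = i},
    (monomial (expo S.1) : K →ₗ[K] MvPolynomial (Fin r) K) ∘ₗ LinearMap.proj S

theorem coeff_squarefreeForm (i : ℕ) (v : {S : Finset (Fin r) // S.card = i} → K)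
    (T : Finset (Fin r)) : coeff (expo T) (squarefreeForm i v) = extendZero v T := by
  simp only [squarefreeForm, LinearMap.sum_apply, LinearMap.comp_apply, LinearMap.proj_apply,
    coeff_sum, coeff_monomial, expo_injective.eq_iff]
  by_cases h : T.card = i
  · rw [extendZero_of_card v h, Finset.sum_eq_single ⟨T, h⟩]
    · simp
    · intro S _ hS
      rw [if_neg fun e => hS (Subtype.ext e)]
    · simp
  · rw [extendZero, dif_neg h]
    exact Finset.sum_eq_zero fun S _ => if_neg fun e : S.1 = T => h (e ▸ S.2)

theorem isHomogeneous_squarefreeForm (i : ℕ) (v : {S : Finset (Fin r) // S.card = i} → K) :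
    (squarefreeForm i v).IsHomogeneous i := by
  simp only [squarefreeForm, LinearMap.sum_apply, LinearMap.comp_apply, LinearMap.proj_apply]
  exact IsHomogeneous.sum _ _ _ fun S _ =>
    isHomogeneous_monomial _ ((degree_expo S.1).trans S.2)

/-- The class in `A_i` of the squarefree form with prescribed coefficients. -/
noncomputable def toGradedPiece (K : Type*) [Field K] (r d i : ℕ) :
    ({S : Finset (Fin r) // S.card = i} → K) →ₗ[K] gradedPiece (squarefreeIdeal K r d) i :=
  ((Ideal.Quotient.mkₐ K (squarefreeIdeal K r d)).toLinearMap ∘ₗ squarefreeForm i).codRestrict _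
    fun v => ⟨squarefreeForm i v, isHomogeneous_squarefreeForm i v, rfl⟩

theorem coe_toGradedPiece (d i : ℕ) (v : {S : Finset (Fin r) // S.card = i} → K) :
    (toGradedPiece K r d i v : MvPolynomial (Fin r) K ⧸ squarefreeIdeal K r d) =
      Ideal.Quotient.mk _ (squarefreeForm i v) := rfl

theorem toGradedPiece_surjective (d i : ℕ) : Function.Surjective (toGradedPiece K r d i) := by
  rintro ⟨_, f, hf, rfl⟩
  refine ⟨fun S => coeff (expo S.1) f, Subtype.ext ?_⟩
  rw [coe_toGradedPiece]
  refine Ideal.Quotient.eq.2 (mem_squarefreeIdeal_iff.2 fun S _ => ?_)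
  rw [coeff_sub, coeff_squarefreeForm]
  by_cases h : S.card = i
  · rw [extendZero_of_card _ h, sub_self]
  · have hf' : f.IsHomogeneous i := hf
    rw [extendZero, dif_neg h, hf'.coeff_eq_zero (by rwa [degree_expo]), sub_self]

theorem toGradedPiece_bijective {d i : ℕ} (hi : i < d) :
    Function.Bijective (toGradedPiece K r d i) := by
  refine ⟨?_, toGradedPiece_surjective d i⟩
  rw [injective_iff_map_eq_zero]
  intro v hv
  have h := congrArg Subtype.val hv
  rw [coe_toGradedPiece] at h
  have h := mem_squarefreeIdeal_iff.1 (Ideal.Quotient.eq_zero_iff_mem.1 h)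
  ext S
  have hS := h S.1 (S.2.trans_lt hi)
  rwa [coeff_squarefreeForm, extendZero_coe] at hS

theorem toGradedPiece_eq_zero {d i : ℕ} (hi : d ≤ i)
    (v : {S : Finset (Fin r) // S.card = i} → K) : toGradedPiece K r d i v = 0 := by
  refine Subtype.ext (Ideal.Quotient.eq_zero_iff_mem.2 (mem_squarefreeIdeal_iff.2 fun S hS => ?_))
  rw [coeff_squarefreeForm, extendZero, dif_neg (by omega)]

theorem mulForm_toGradedPiece (d i : ℕ) (a : Fin r → K)
    (hl : (∑ j, a j • X j : MvPolynomial (Fin r) K).IsHomogeneous 1)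
    (v : {S : Finset (Fin r) // S.card = i} → K) :
    mulForm (squarefreeIdeal K r d) hl i (toGradedPiece K r d i v) =
      toGradedPiece K r d (i + 1) (raise a i v) := by
  refine Subtype.ext (Ideal.Quotient.eq.2 (mem_squarefreeIdeal_iff.2 fun T _ => ?_))
  rw [coeff_sub, sub_eq_zero, coeff_squarefreeForm]
  change coeff (expo T) ((∑ j, a j • X j) * squarefreeForm i v) = _
  rw [Finset.sum_mul, coeff_sum]
  have h : ∀ j, coeff (expo T) (a j • X j * squarefreeForm i v) =
      if j ∈ T then a j * extendZero v (T.erase j) else 0 := by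
    intro j
    have hj : j ∈ (expo T).support ↔ j ∈ T := by simp [expo_apply]
    rw [smul_mul_assoc, coeff_smul, coeff_X_mul', smul_eq_mul]
    simp only [hj]
    split_ifs with hT
    · rw [expo_erase hT, coeff_squarefreeForm]
    · rw [mul_zero]
  rw [Finset.sum_congr rfl fun j _ => h j, Finset.sum_ite_mem, Finset.univ_inter]
  by_cases hT : T.card = i + 1
  · rw [extendZero_of_card _ hT, raise_apply]
  · rw [extendZero, dif_neg hT]
    refine Finset.sum_eq_zero fun j hj => ?_
    have hne : (T.erase j).card ≠ i := by
      have := Finset.card_pos.2 ⟨j, hj⟩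
      rw [Finset.card_erase_of_mem hj]; omega
    rw [extendZero, dif_neg hne, mul_zero]

theorem isHomogeneous_sum_smul_X (a : Fin r → K) :
    (∑ j, a j • X j : MvPolynomial (Fin r) K).IsHomogeneous 1 :=
  IsHomogeneous.sum _ _ _ fun j _ => by
    rw [smul_eq_C_mul]
    exact isHomogeneous_C_mul_X _ _

theorem exists_eq_sum_smul_X {l : MvPolynomial (Fin r) K} (hl : l.IsHomogeneous 1) :
    ∃ a : Fin r → K, l = ∑ j, a j • X j := by
  have h : l ∈ homogeneousSubmodule (Fin r) K 1 := hl
  rw [homogeneousSubmodule_one_eq_span_X, Submodule.mem_span_range_iff_exists_fun] at h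
  obtain ⟨a, ha⟩ := h
  exact ⟨a, ha.symm⟩

theorem mulForm_injective_or_surjective_iff (d i : ℕ) (a : Fin r → K)
    (hl : (∑ j, a j • X j : MvPolynomial (Fin r) K).IsHomogeneous 1) :
    (Function.Injective (mulForm (squarefreeIdeal K r d) hl i) ∨
      Function.Surjective (mulForm (squarefreeIdeal K r d) hl i)) ↔
    (i + 1 < d → Function.Injective (raise a i) ∨ Function.Surjective (raise a i)) := by
  rcases lt_or_ge (i + 1) d with hi | hi
  · have b0 := toGradedPiece_bijective (K := K) (r := r) (show i < d by omega)
    have b1 := toGradedPiece_bijective (K := K) (r := r) hi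
    have hc : mulForm (squarefreeIdeal K r d) hl i ∘ toGradedPiece K r d i =
        toGradedPiece K r d (i + 1) ∘ raise a i :=
      funext fun v => mulForm_toGradedPiece d i a hl v
    rw [← Function.Injective.of_comp_iff' _ b0, ← Function.Surjective.of_comp_iff _ b0.2, hc,
      Function.Injective.of_comp_iff b1.1, Function.Surjective.of_comp_iff' b1]
    exact ⟨fun h _ => h, fun h => h hi⟩
  · -- In this range the target `A_{i+1}` is zero.
    refine iff_of_true (Or.inr fun y => ?_) fun h => absurd h (by omega)
    obtain ⟨w, rfl⟩ := toGradedPiece_surjective d (i + 1) y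
    exact ⟨0, by rw [map_zero, toGradedPiece_eq_zero hi]⟩

theorem hasWLP_squarefreeIdeal_iff_exists_raise (d : ℕ) :
    HasWLP (squarefreeIdeal K r d) ↔ ∃ a : Fin r → K, ∀ i, i + 1 < d →
      Function.Injective (raise a i) ∨ Function.Surjective (raise a i) := by
  constructor
  · rintro ⟨l, hl, h⟩
    obtain ⟨a, rfl⟩ := exists_eq_sum_smul_X hl
    exact ⟨a, fun i => (mulForm_injective_or_surjective_iff d i a hl).1 (h i)⟩
  · rintro ⟨a, h⟩
    exact ⟨_, isHomogeneous_sum_smul_X a,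
      fun i => (mulForm_injective_or_surjective_iff d i a _).2 (h i)⟩

end SquarefreeAlgebra

/-! ### The failing characteristics -/

section Characteristic

variable {K : Type*} [Field K]

theorem exists_raise_iff (p : ℕ) [CharP K p] (r d : ℕ) :
    (∃ a : Fin r → K, ∀ i, i + 1 < d →
      Function.Injective (raise a i) ∨ Function.Surjective (raise a i)) ↔
    ¬ (p.Prime ∧ p < d ∧ 2 * p ≤ r + 1) := by
  constructor
  · rintro ⟨a, h⟩ ⟨hp, hpd, hpr⟩
    have hq : p - 1 + 1 = p := Nat.sub_add_cancel hp.one_le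
    exact not_raise_injective_or_surjective hq hpr a (h (p - 1) (by omega))
  · intro h
    refine ⟨1, fun i hi => raise_one_injective_or_surjective p ?_⟩
    rintro ⟨hp, h1, h2⟩
    exact h ⟨hp, by omega, by omega⟩

theorem forall_rank_inclusionMatrix_iff (F : Type*) [Field F] (p : ℕ) [CharP F p] (r d : ℕ) :
    (∀ i : ℕ, i + 1 < d →
      (inclusionMatrix F r i).rank = min (r.choose i) (r.choose (i + 1))) ↔
    ¬ (p.Prime ∧ p < d ∧ 2 * p ≤ r + 1) := by
  simp only [rank_inclusionMatrix_eq_min_iff]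
  constructor
  · exact fun h => (exists_raise_iff (K := F) p r d).1 ⟨1, h⟩
  · intro h i hi
    refine raise_one_injective_or_surjective p ?_
    rintro ⟨hp, h1, h2⟩
    exact h ⟨hp, by omega, by omega⟩

theorem le_ceil_half_iff (p r : ℕ) : p ≤ ⌈(r : ℚ) / 2⌉₊ ↔ 2 * p ≤ r + 1 := by
  rcases p with _ | q
  · simp
  · rw [Nat.add_one_le_iff, Nat.lt_ceil, lt_div_iff₀ two_pos]
    constructor
    · intro h
      have : q * 2 < r := by exact_mod_cast h
      omega
    · intro h
      have : q * 2 < r := by omega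
      exact_mod_cast this

end Characteristic

end Lefschetz

theorem mainTheorem5 {K : Type*} [Field K] (p : ℕ) [CharP K p] (r d : ℕ) :
    -- the WLP holds unless `p` is a prime less than `i + 2` for some `1 ≤ i ≤ ⌈r/2⌉`
    ((¬ ∃ i : ℕ, 1 ≤ i ∧ i ≤ ⌈(r : ℚ) / 2⌉₊ ∧ p.Prime ∧ p < i + 2) →
      Lefschetz.HasWLP (Lefschetz.squarefreeIdeal K r d)) ∧
    -- the exact set of characteristics in which the WLP fails
    (¬ Lefschetz.HasWLP (Lefschetz.squarefreeIdeal K r d) ↔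
      p.Prime ∧ p < d ∧ p ≤ ⌈(r : ℚ) / 2⌉₊) ∧
    -- the WLP amounts to full rank of the inclusion maps over any field of characteristic `p`
    (∀ (F : Type*) [Field F] [CharP F p],
      Lefschetz.HasWLP (Lefschetz.squarefreeIdeal K r d) ↔
        ∀ i : ℕ, i + 1 < d →
          (Lefschetz.inclusionMatrix F r i).rank = min (r.choose i) (r.choose (i + 1))) := by
  have hW : Lefschetz.HasWLP (Lefschetz.squarefreeIdeal K r d) ↔
      ¬ (p.Prime ∧ p < d ∧ p ≤ ⌈(r : ℚ) / 2⌉₊) := by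
    rw [Lefschetz.hasWLP_squarefreeIdeal_iff_exists_raise, Lefschetz.exists_raise_iff p,
      Lefschetz.le_ceil_half_iff]
  refine ⟨fun h => hW.2 ?_, ?_, ?_⟩
  · rintro ⟨hp, -, hpr⟩
    exact h ⟨p, hp.one_le, hpr, hp, by omega⟩
  · rw [hW, not_not]
  · intro F _ _
    rw [hW, Lefschetz.forall_rank_inclusionMatrix_iff F p, Lefschetz.le_ceil_half_iff]
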